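/- Let $K$ be a $p$-adic field (a nonarchimedean local field of characteristic $0$; $p=2$ is allowed, and $K/\mathbb{Q}_p$ may be ramified), with valuation ring $R$, residue field of order $q$, valuation $v$ normalized to have value group $\mathbb{Z}$, and absolute value $|a|_K=q^{-v(a)}$. Let $M$ be a symmetric $n\times n$ matrix with entries in $R$, let $r$ be its rank over $K$, and let $Q(x_1,\ldots,x_n)=(x_1,\ldots,x_n)\,M\,(x_1,\ldots,x_n)^T$ be the associated quadratic form. For $s\in\mathbb{C}$ with $\operatorname{Re}(s)>0$ let $$Z_Q(s)=\int_{R^n}|Q(x_1,\ldots,x_n)|_K^s\,dx_1\cdots dx_n$$ be its Igusa local zeta function, where $dx_1\cdots dx_n$ is the Haar measure on $R^n$ with total mass $1$. Then this integral converges for all $s$ with $\operatorname{Re}(s)>0$, and there is a polynomial $f(t)\in\mathbb{Q}[t]$ such that the rational function $$Z(t)=\frac{f(t)}{\left(1-\frac{t}{q}\right)\left(1-\frac{t^2}{q^r}\right)}\in\mathbb{Q}(t)$$ has no pole at $t=q^{-s}$ and satisfies $Z_Q(s)=Z(q^{-s})$ for all $s$ with $\operatorname{Re}(s)>0$. Consequently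 $Z(t)$, the Igusa local zeta function as a rational function of $t=q^{-s}$, has at most three poles in $\mathbb{C}$, counted with multiplicity. -/

import Mathlib

open scoped ValuativeRel

noncomputable section

namespace IgusaZeta

open MeasureTheory IsNonarchimedeanLocalField

variable (K : Type*) [Field K] [ValuativeRel K] [TopologicalSpace K]
  [IsNonarchimedeanLocalField K]

/-- The order `q` of the residue field of `K`. -/
def residueCard : ℕ := Nat.card 𝓀[K]

theorem residueCard_ne_zero : ((residueCard K : ℕ) : NNReal) ≠ 0 :=
  Nat.cast_ne_zero.mpr Nat.card_pos.ne'

variable {K}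

/-- The normalized absolute value `|a|_K = q ^ (-v(a))` (with `|0|_K = 0`), where `v` is the
valuation of `K` with value group `ℤ`.  (The ordered group `ℤ` has no nontrivial automorphism, so
the identification of the value group with `ℤ` is unique.) -/
def absK (a : K) : ℝ :=
  (WithZeroMulInt.toNNReal (residueCard_ne_zero K)
    (valueGroupWithZeroIsoInt K (ValuativeRel.valuation K a)) : ℝ)

/-- The Haar measure `dx₁ ⋯ dxₙ` on `Rⁿ`, where `R` is the valuation ring, of total mass `1`. -/
def haarPow [MeasurableSpace K] [BorelSpace K] (n : ℕ) : Measure (Fin n → 𝒪[K]) :=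
  Measure.pi fun _ => Measure.addHaarMeasure ⊤

/-- The integrand `|f(x)|_K ^ s` as a function on `Rⁿ`. -/
def integrand {n : ℕ} (f : MvPolynomial (Fin n) K) (s : ℂ) (x : Fin n → 𝒪[K]) : ℂ :=
  ((absK (MvPolynomial.eval (fun i => (x i : K)) f) : ℝ) : ℂ) ^ s

/-- The Igusa local zeta function `Z_f(s) = ∫_{Rⁿ} |f(x)|_K ^ s dx` (used for `Re s > 0`). -/
def igusaZeta [MeasurableSpace K] [BorelSpace K] {n : ℕ} (f : MvPolynomial (Fin n) K)
    (s : ℂ) : ℂ :=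
  ∫ x, integrand f s x ∂(haarPow n)

/-- `Z ∈ ℚ(t)` is the Igusa local zeta function of `f` as a rational function of `t = q ^ (-s)`:
for every `s` with `Re s > 0` the integral `Z_f(s)` converges, `Z` has no pole at `q ^ (-s)`, and
`Z_f(s) = Z(q ^ (-s))`.  (Such a `Z` is unique, since these `q ^ (-s)` form an infinite set.) -/
def IsIgusaZeta [MeasurableSpace K] [BorelSpace K] {n : ℕ} (f : MvPolynomial (Fin n) K)
    (Z : RatFunc ℚ) : Prop :=
  ∀ s : ℂ, 0 < s.re →
    Integrable (integrand f s) (haarPow n) ∧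
    Polynomial.aeval ((residueCard K : ℂ) ^ (-s)) Z.denom ≠ 0 ∧
    igusaZeta f s = Z.eval (algebraMap ℚ ℂ) ((residueCard K : ℂ) ^ (-s))

/-- The quadratic form `(x₁, …, xₙ) M (x₁, …, xₙ)ᵀ` attached to a matrix `M` over `R`. -/
def quadForm {n : ℕ} (M : Matrix (Fin n) (Fin n) 𝒪[K]) : MvPolynomial (Fin n) K :=
  ∑ i, ∑ j, MvPolynomial.C ((M i j : 𝒪[K]) : K) * MvPolynomial.X i * MvPolynomial.X j

/-- The rank of a quadratic form: the rank of its matrix, over the field `K`. -/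
def formRank {n : ℕ} (M : Matrix (Fin n) (Fin n) 𝒪[K]) : ℕ :=
  (M.map (fun a : 𝒪[K] => (a : K))).rank

/-- The poles in `ℂ` of a rational function, with multiplicity: the roots of its denominator in
lowest terms. -/
def complexPoles (Z : RatFunc ℚ) : Multiset ℂ := Z.denom.aroots ℂ

end IgusaZeta

end

open MeasureTheory
open scoped ValuativeRel

/-! Write t = q^(-s). The map w(a) = |a|^s on R is multiplicative, trivial on units and sends a
prime element ϖ to t. The argument uses only this, so it is run for every such w at once, and it
yields a polynomial in w(ϖ) chosen before w; hence f does not depend on s.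

A symmetric M factors over R as Aᵀ N A, with A right invertible and N nondegenerate of size r. Since
A carries Haar measure on R^n to Haar measure on R^r, M may be replaced by N.

For nondegenerate Q, split R^r by residues mod ϖ. By homogeneity the zero class contributes t²/q^r
times the whole integral, which accounts for the factor 1 - t²/q^r. On a primitive vector the
gradient 2Nx cannot be divisible by a power of ϖ that does not divide 2 det N, by the adjugate
identity. So the primitive vectors split into finitely many small cosets. On each of them either |Q|
is constant, or Q is a power of ϖ times a function with a unit partial derivative, and the latter
integrates like a coordinate: ∫ w(u) du = (1 - 1/q)/(1 - t/q). Thus 1 - t/q clears all remaining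
denominators.

The form is never diagonalized. The prime 2 enters only through 2 det N ≠ 0, so residue
characteristic 2 needs no separate treatment. -/

/-- A multiplicative function on a discrete valuation ring that is trivial on units and of absolute
value less than one on the prime element `ϖ`, such as `a ↦ |a| ^ s` with `Re s > 0`. -/
structure IsUnramifiedChar {R : Type*} [CommRing R] (ϖ : R) (w : R →*₀ ℂ) : Prop where
  map_unit : ∀ u : Rˣ, w u = 1
  norm_lt_one : ‖w ϖ‖ < 1

/-! ### Unramified characters on a discrete valuation ring -/

section DVR

variable {R : Type*} [CommRing R] [IsDomain R] [IsDiscreteValuationRing R] {ϖ : R}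

theorem isUnit_one_add_prime_mul (hϖ : Irreducible ϖ) (c : R) : IsUnit (1 + ϖ * c) := by
  by_contra h
  have h1 : 1 + ϖ * c ∈ IsLocalRing.maximalIdeal R := h
  have h2 : ϖ * c ∈ IsLocalRing.maximalIdeal R :=
    Ideal.mul_mem_right _ _ ((IsLocalRing.mem_maximalIdeal _).2 hϖ.not_isUnit)
  have h3 := Ideal.sub_mem _ h1 h2
  rw [add_sub_cancel_right] at h3
  exact (Ideal.ne_top_iff_one _).1 (IsLocalRing.maximalIdeal.isMaximal R).ne_top h3

theorem exists_unit_mul_pow_of_not_dvd (hϖ : Irreducible ϖ) {x : R} {n : ℕ} (hx : ¬ ϖ ^ n ∣ x) :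
    ∃ k < n, ∃ u : Rˣ, x = u * ϖ ^ k := by
  have hx0 : x ≠ 0 := fun h => hx (h ▸ dvd_zero _)
  obtain ⟨k, u, rfl⟩ := IsDiscreteValuationRing.eq_unit_mul_pow_irreducible hx0 hϖ
  refine ⟨k, ?_, u, rfl⟩
  by_contra h
  exact hx ((pow_dvd_pow ϖ (not_lt.1 h)).mul_left _)

theorem eq_zero_of_forall_pow_dvd (hϖ : Irreducible ϖ) {x : R} (h : ∀ n, ϖ ^ n ∣ x) : x = 0 := by
  by_contra hx
  obtain ⟨k, u, rfl⟩ := IsDiscreteValuationRing.eq_unit_mul_pow_irreducible hx hϖ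
  have h1 := (Units.dvd_mul_left).1 (h (k + 1))
  exact absurd ((pow_dvd_pow_iff hϖ.ne_zero hϖ.not_isUnit).1 h1) (by omega)

namespace IsUnramifiedChar

variable {w : R →*₀ ℂ}

omit [IsDomain R] [IsDiscreteValuationRing R] in
theorem map_isUnit (hw : IsUnramifiedChar ϖ w) {x : R} (hx : IsUnit x) : w x = 1 := by
  obtain ⟨u, rfl⟩ := hx
  exact hw.map_unit u

/-- If v(x) < n, then adding a multiple of ϖ^n multiplies x by a unit of the form 1 + ϖc. -/
theorem map_eq_of_dvd_sub (hw : IsUnramifiedChar ϖ w) (hϖ : Irreducible ϖ) {x y : R} {n : ℕ}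
    (hx : ¬ ϖ ^ n ∣ x) (hxy : ϖ ^ n ∣ y - x) : w y = w x := by
  obtain ⟨k, hk, u, rfl⟩ := exists_unit_mul_pow_of_not_dvd hϖ hx
  obtain ⟨z, hz⟩ := hxy
  obtain ⟨m, rfl⟩ : ∃ m, n = k + 1 + m := ⟨n - (k + 1), by omega⟩
  have hy : y = u * ϖ ^ k * (1 + ϖ * (ϖ ^ m * z * ↑u⁻¹)) := by
    have hu : (u : R) * ↑u⁻¹ = 1 := u.mul_inv
    rw [eq_add_of_sub_eq hz]
    linear_combination (-ϖ ^ (k + 1 + m) * z) * hu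
  rw [hy, map_mul, hw.map_isUnit (isUnit_one_add_prime_mul hϖ _), mul_one]

theorem norm_map_le (hw : IsUnramifiedChar ϖ w) (hϖ : Irreducible ϖ) {x : R} {n : ℕ}
    (hx : ϖ ^ n ∣ x) : ‖w x‖ ≤ ‖w ϖ‖ ^ n := by
  obtain ⟨z, rfl⟩ := hx
  rw [map_mul, map_pow, norm_mul, norm_pow]
  refine mul_le_of_le_one_right (by positivity) ?_
  by_cases hz : z = 0
  · simp [hz]
  obtain ⟨k, u, rfl⟩ := IsDiscreteValuationRing.eq_unit_mul_pow_irreducible hz hϖ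
  rw [map_mul, hw.map_unit, one_mul, map_pow, norm_pow]
  exact pow_le_one₀ (norm_nonneg _) hw.norm_lt_one.le

end IsUnramifiedChar

/-! ### Continuity of characters and a Hensel-type root lemma -/

section Topology

variable [TopologicalSpace R] [IsTopologicalRing R] [CompactSpace R] [T2Space R]

theorem isOpen_setOf_pow_dvd (hϖ : Irreducible ϖ) (n : ℕ) : IsOpen {x : R | ϖ ^ n ∣ x} := by
  have h := IsLocalRing.isOpen_maximalIdeal_pow R n
  rw [hϖ.maximalIdeal_eq, Ideal.span_singleton_pow] at h
  convert h using 1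
  ext x
  exact Ideal.mem_span_singleton.symm

theorem isClosed_setOf_pow_dvd (n : ℕ) : IsClosed {x : R | ϖ ^ n ∣ x} := by
  convert IsNoetherianRing.isClosed_ideal (Ideal.span {ϖ ^ n} : Ideal R) using 1
  ext x
  exact Ideal.mem_span_singleton.symm

theorem setOf_pow_dvd_sub_mem_nhds (hϖ : Irreducible ϖ) (n : ℕ) (x : R) :
    {y : R | ϖ ^ n ∣ y - x} ∈ nhds x := by
  refine IsOpen.mem_nhds ?_ (by simp)
  exact (isOpen_setOf_pow_dvd hϖ n).preimage (f := fun y => y - x) (by fun_prop)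

theorem IsUnramifiedChar.continuous {w : R →*₀ ℂ} (hw : IsUnramifiedChar ϖ w)
    (hϖ : Irreducible ϖ) : Continuous w := by
  rw [continuous_iff_continuousAt]
  intro x
  by_cases hx : x = 0
  · subst hx
    rw [ContinuousAt, map_zero, Metric.tendsto_nhds]
    intro ε hε
    obtain ⟨n, hn⟩ := exists_pow_lt_of_lt_one hε hw.norm_lt_one
    filter_upwards [setOf_pow_dvd_sub_mem_nhds hϖ n 0] with y hy
    rw [dist_zero_right]
    exact (hw.norm_map_le hϖ (by simpa using hy)).trans_lt hn
  · obtain ⟨n, hn⟩ : ∃ n, ¬ ϖ ^ n ∣ x := by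
      by_contra! h
      exact hx (eq_zero_of_forall_pow_dvd hϖ h)
    refine continuousAt_const.congr (f := fun _ => w x) ?_
    filter_upwards [setOf_pow_dvd_sub_mem_nhds hϖ n x] with y hy
    exact (hw.map_eq_of_dvd_sub hϖ hn hy).symm

/-- Newton's method with derivative ≡ 1 mod ϖ: replacing u by u - g(u) turns g(u) into -g(u)ϖc,
gaining a factor ϖ. Compactness of the nested closed sets {ϖ^n ∣ g} replaces convergence of the
iteration. -/
theorem exists_root_of_add_eq (hϖ : Irreducible ϖ) {g : R → R} (hg : Continuous g)
    (h : ∀ u a, ∃ c, g (u + a) = g u + a * (1 + ϖ * c)) : ∃ u, g u = 0 := by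
  obtain ⟨u, hu⟩ := IsCompact.nonempty_iInter_of_sequence_nonempty_isCompact_isClosed
    (fun n => {u | ϖ ^ n ∣ g u}) (fun n u hu => (pow_dvd_pow ϖ n.le_succ).trans hu)
    (fun n => by
      induction n with
      | zero => exact ⟨0, by simp⟩
      | succ n ih =>
        obtain ⟨u, b, hb⟩ := ih
        obtain ⟨c, hc⟩ := h u (-g u)
        refine ⟨u + -g u, -b * c, ?_⟩
        rw [hc, hb]
        ring)
    ((isClosed_setOf_pow_dvd 0).preimage hg).isCompact
    (fun n => (isClosed_setOf_pow_dvd n).preimage hg)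
  exact ⟨u, eq_zero_of_forall_pow_dvd hϖ (Set.mem_iInter.1 hu)⟩

end Topology

end DVR

/-! ### Averaging against Haar measure on a compact group -/

section Haar

variable {G : Type*} [AddCommGroup G] [TopologicalSpace G] [IsTopologicalAddGroup G]
  [CompactSpace G] [MeasurableSpace G] [BorelSpace G]
  (μ : Measure G) [μ.IsAddHaarMeasure] [IsProbabilityMeasure μ]

omit [IsTopologicalAddGroup G] [IsProbabilityMeasure μ] in
theorem Continuous.integrable_of_compactSpace {f : G → ℂ} (hf : Continuous f) : Integrable f μ :=
  hf.integrable_of_hasCompactSupport (HasCompactSupport.of_compactSpace f)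

/-- By translation invariance the integral is unchanged when φ is shifted by any ξ in F; averaging
over all ξ makes the integrand constant. -/
theorem integral_comp_addMonoidHom_finite {F : Type*} [AddCommGroup F] [Fintype F] (φ : G →+ F)
    (hφ : Function.Surjective φ) (hker : IsOpen (φ.ker : Set G)) (g : F → ℂ) :
    ∫ x, g (φ x) ∂μ = (Fintype.card F : ℂ)⁻¹ * ∑ ξ, g ξ := by
  let _ : TopologicalSpace F := ⊥
  have : DiscreteTopology F := ⟨rfl⟩
  have hc : Continuous φ := by
    refine continuous_of_continuousAt_zero φ ?_
    rw [ContinuousAt, map_zero, nhds_discrete F, Filter.tendsto_pure]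
    exact hker.mem_nhds (zero_mem φ.ker)
  have hcard : (Fintype.card F : ℂ) ≠ 0 := Nat.cast_ne_zero.2 Fintype.card_ne_zero
  rw [eq_inv_mul_iff_mul_eq₀ hcard]
  have h1 : ∀ ξ : F, ∫ x, g (φ x + ξ) ∂μ = ∫ x, g (φ x) ∂μ := by
    intro ξ
    obtain ⟨a, rfl⟩ := hφ ξ
    simp_rw [← map_add]
    exact integral_add_right_eq_self (fun x => g (φ x)) a
  calc (Fintype.card F : ℂ) * ∫ x, g (φ x) ∂μ = ∑ ξ : F, ∫ x, g (φ x + ξ) ∂μ := by simp [h1]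
    _ = ∫ x, ∑ ξ : F, g (φ x + ξ) ∂μ := by
      refine (integral_finsetSum _ fun ξ _ => Continuous.integrable_of_compactSpace μ ?_).symm
      exact (continuous_of_discreteTopology (f := fun η => g (η + ξ))).comp hc
    _ = ∫ x, ∑ ξ : F, g ξ ∂μ := by
      congr 1 with x
      exact Fintype.sum_equiv (Equiv.addLeft (φ x)) _ _ fun ξ => rfl
    _ = _ := by simp

omit [IsProbabilityMeasure μ] in
theorem integral_integral_add_eq {H : Type*} [TopologicalSpace H] [CompactSpace H]
    [MeasurableSpace H] [OpensMeasurableSpace H] (ν : Measure H) [IsProbabilityMeasure ν]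
    {f : G → ℂ} (hf : Continuous f) {φ : H → G} (hφ : Continuous φ) :
    ∫ x, ∫ y, f (x + φ y) ∂ν ∂μ = ∫ x, f x ∂μ := by
  rw [integral_integral_swap_of_hasCompactSupport (f := fun x y => f (x + φ y))
    (by simp only [Function.uncurry_def]; fun_prop) (HasCompactSupport.of_compactSpace _)]
  simp [integral_add_right_eq_self]

end Haar

/-! ### Decomposition into residue classes, and integrals of coordinate type -/

section Cosets

variable {R : Type*} [CommRing R]

/-- Reduction modulo `a` in each coordinate. -/
noncomputable def reducePi (a : R) (r : ℕ) : (Fin r → R) →+ (Fin r → R ⧸ Ideal.span {a}) :=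
  (Ideal.Quotient.mk (Ideal.span {a})).toAddMonoidHom.compLeft (Fin r)

/-- A lift of a residue vector. -/
noncomputable def liftPi {a : R} {r : ℕ} (ξ : Fin r → R ⧸ Ideal.span {a}) : Fin r → R :=
  fun i => Quotient.out (ξ i)

theorem reducePi_liftPi {a : R} {r : ℕ} (ξ : Fin r → R ⧸ Ideal.span {a}) :
    reducePi a r (liftPi ξ) = ξ := by
  ext i
  exact Ideal.Quotient.mk_out (ξ i)

theorem reducePi_eq_iff {a : R} {r : ℕ} {x y : Fin r → R} :
    reducePi a r x = reducePi a r y ↔ ∃ z : Fin r → R, x = y + a • z := by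
  constructor
  · intro h
    have h1 : ∀ i, ∃ z, x i = y i + a * z := fun i => by
      obtain ⟨z, hz⟩ := Ideal.mem_span_singleton.1 (Ideal.Quotient.eq.1 (congrFun h i))
      exact ⟨z, by rw [← hz]; ring⟩
    choose z hz using h1
    exact ⟨z, funext hz⟩
  · rintro ⟨z, rfl⟩
    ext i
    refine Ideal.Quotient.eq.2 (Ideal.mem_span_singleton.2 ⟨z i, ?_⟩)
    simp

variable [IsDomain R] [IsDiscreteValuationRing R] {ϖ : R}
  [TopologicalSpace R] [IsTopologicalRing R] [CompactSpace R] [T2Space R]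

theorem finite_quotient_span_prime_pow (hϖ : Irreducible ϖ) (N : ℕ) :
    Finite (R ⧸ Ideal.span {ϖ ^ N}) := by
  refine IsLocalRing.isOpen_iff_finite_quotient.1 ?_
  rw [IsDiscreteValuationRing.isOpen_iff]
  simp [hϖ.ne_zero]

theorem isOpen_ker_reducePi (hϖ : Irreducible ϖ) (N r : ℕ) :
    IsOpen ((reducePi (ϖ ^ N) r).ker : Set (Fin r → R)) := by
  have h : ((reducePi (ϖ ^ N) r).ker : Set (Fin r → R)) =
      Set.univ.pi fun _ => {x : R | ϖ ^ N ∣ x} := by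
    ext x
    simp [reducePi, funext_iff, Ideal.Quotient.eq_zero_iff_mem, Ideal.mem_span_singleton]
  rw [h]
  exact isOpen_set_pi Set.finite_univ fun _ _ => isOpen_setOf_pow_dvd hϖ N

variable [MeasurableSpace R] [BorelSpace R] [SecondCountableTopology R]

/-- Averaging f over ϖ^N R^r leaves its integral unchanged and makes it a function of the residue
class, that is, a function on a finite group. -/
theorem integral_eq_sum_cosets (hϖ : Irreducible ϖ) (N : ℕ) {r : ℕ} (μ : Measure (Fin r → R))
    [μ.IsAddHaarMeasure] [IsProbabilityMeasure μ] [Fintype (R ⧸ Ideal.span {ϖ ^ N})]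
    {f : (Fin r → R) → ℂ} (hf : Continuous f) :
    ∫ x, f x ∂μ = ((Fintype.card (R ⧸ Ideal.span {ϖ ^ N}) : ℂ) ^ r)⁻¹ *
      ∑ ξ : Fin r → R ⧸ Ideal.span {ϖ ^ N}, ∫ y, f (liftPi ξ + ϖ ^ N • y) ∂μ := by
  have h1 : ∀ x, ∫ y, f (x + ϖ ^ N • y) ∂μ =
      ∫ y, f (liftPi (reducePi (ϖ ^ N) r x) + ϖ ^ N • y) ∂μ := by
    intro x
    obtain ⟨z, hz⟩ := reducePi_eq_iff.1 (reducePi_liftPi (reducePi (ϖ ^ N) r x)).symm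
    nth_rw 1 [hz]
    rw [← integral_add_left_eq_self (μ := μ)
      (fun y => f (liftPi (reducePi (ϖ ^ N) r x) + ϖ ^ N • y)) z]
    simp only [smul_add, add_assoc]
  rw [← integral_integral_add_eq μ μ hf (φ := fun y => ϖ ^ N • y) (by fun_prop)]
  rw [funext h1]
  rw [integral_comp_addMonoidHom_finite μ (reducePi (ϖ ^ N) r)
    (fun ξ => ⟨_, reducePi_liftPi ξ⟩) (isOpen_ker_reducePi hϖ N r)
    (fun ξ => ∫ y, f (liftPi ξ + ϖ ^ N • y) ∂μ)]
  simp

variable {w : R →*₀ ℂ}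

/-- The integral I satisfies qI = (q - 1) + w(ϖ)I: the nonzero residue classes consist of units, and
the zero class is a rescaled copy of R. The variable lives in `Fin 1 → R` so that the coset formula
applies with r = 1. -/
theorem one_sub_mul_integral_coord (hϖ : Irreducible ϖ) (hw : IsUnramifiedChar ϖ w)
    (ν : Measure (Fin 1 → R)) [ν.IsAddHaarMeasure] [IsProbabilityMeasure ν] :
    (1 - w ϖ / (Nat.card (R ⧸ Ideal.span {ϖ}) : ℂ)) * ∫ u, w (u 0) ∂ν =
      1 - 1 / (Nat.card (R ⧸ Ideal.span {ϖ}) : ℂ) := by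
  classical
  have hfin := finite_quotient_span_prime_pow hϖ 1
  have := Fintype.ofFinite (R ⧸ Ideal.span {ϖ ^ 1})
  have hcont := hw.continuous hϖ
  have h := integral_eq_sum_cosets hϖ 1 ν (f := fun u => w (u 0)) (by fun_prop)
  have hq : (Fintype.card (R ⧸ Ideal.span {ϖ ^ 1})) = Nat.card (R ⧸ Ideal.span {ϖ}) := by
    rw [← Nat.card_eq_fintype_card, pow_one]
  have hq0 : (Nat.card (R ⧸ Ideal.span {ϖ}) : ℂ) ≠ 0 := by
    rw [← hq]; exact Nat.cast_ne_zero.2 Fintype.card_ne_zero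
  have hterm : ∀ ξ : Fin 1 → R ⧸ Ideal.span {ϖ ^ 1}, ∫ y, w ((liftPi ξ + ϖ ^ 1 • y) 0) ∂ν =
      1 + if ξ = 0 then w ϖ * (∫ u, w (u 0) ∂ν) - 1 else 0 := by
    intro ξ
    split_ifs with hξ
    · obtain ⟨z, hz⟩ := reducePi_eq_iff.1
        ((reducePi_liftPi ξ).trans (hξ.trans (map_zero (reducePi (ϖ ^ 1) 1)).symm))
      rw [hz, ← integral_const_mul, add_sub_cancel]
      rw [← integral_sub_right_eq_self (fun y => w ((0 + ϖ ^ 1 • z + ϖ ^ 1 • y) 0)) z]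
      congr 1 with y
      simp [← mul_add]
    · have hd : ¬ ϖ ∣ liftPi ξ 0 := by
        intro hd
        apply hξ
        rw [← reducePi_liftPi ξ]
        ext i
        obtain rfl := Subsingleton.elim i 0
        exact Ideal.Quotient.eq_zero_iff_mem.2 (Ideal.mem_span_singleton.2 (by simpa using hd))
      have h1 : ∀ y : Fin 1 → R, w ((liftPi ξ + ϖ ^ 1 • y) 0) = 1 := by
        intro y
        rw [hw.map_eq_of_dvd_sub hϖ (x := liftPi ξ 0) (n := 1) (by simpa using hd) (by simp)]
        obtain ⟨k, hk, u, hu⟩ := exists_unit_mul_pow_of_not_dvd hϖ (n := 1) (by simpa using hd)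
        obtain rfl : k = 0 := by omega
        rw [hu, map_mul, hw.map_unit, pow_zero, map_one, mul_one]
      rw [funext h1]
      simp
  simp_rw [hterm] at h
  rw [Finset.sum_add_distrib, Finset.sum_ite_eq' Finset.univ] at h
  simp only [Finset.sum_const, Finset.card_univ, Fintype.card_fun, Fintype.card_fin, pow_one, hq,
    Finset.mem_univ, if_true, nsmul_eq_mul, mul_one] at h
  set q : ℂ := (Nat.card (R ⧸ Ideal.span {ϖ}) : ℂ)
  set I := ∫ u, w (u 0) ∂ν
  field_simp at h ⊢
  linear_combination h

omit [SecondCountableTopology R] in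
-- Around a root u₀ of g, g(u) is u - u₀ times a unit, so w ∘ g is a translate of w.
theorem integral_comp_eq_of_add_eq (hϖ : Irreducible ϖ) (hw : IsUnramifiedChar ϖ w)
    (ν : Measure (Fin 1 → R)) [ν.IsAddHaarMeasure] [IsProbabilityMeasure ν]
    {g : R → R} (hg : Continuous g)
    (h : ∀ u a, ∃ c, g (u + a) = g u + a * (1 + ϖ * c)) :
    ∫ u, w (g (u 0)) ∂ν = ∫ u, w (u 0) ∂ν := by
  obtain ⟨u₀, hu₀⟩ := exists_root_of_add_eq hϖ hg h
  have h1 : ∀ u, w (g u) = w (u - u₀) := by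
    intro u
    obtain ⟨c, hc⟩ := h u₀ (u - u₀)
    rw [add_sub_cancel, hu₀, zero_add] at hc
    rw [hc, map_mul, hw.map_isUnit (isUnit_one_add_prime_mul hϖ c), mul_one]
  simp_rw [h1]
  exact integral_sub_right_eq_self (fun u : Fin 1 → R => w (u 0)) (fun _ => u₀)

/-- Averaging over the line R·e reduces to the one-variable case, whose value is the same on every
line. -/
theorem integral_comp_eq_of_add_smul_eq (hϖ : Irreducible ϖ) (hw : IsUnramifiedChar ϖ w)
    (ν : Measure (Fin 1 → R)) [ν.IsAddHaarMeasure] [IsProbabilityMeasure ν] {r : ℕ}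
    (μ : Measure (Fin r → R)) [μ.IsAddHaarMeasure] [IsProbabilityMeasure μ]
    {F : (Fin r → R) → R} (hF : Continuous F) (e : Fin r → R)
    (h : ∀ y a, ∃ c, F (y + a • e) = F y + a * (1 + ϖ * c)) :
    ∫ y, w (F y) ∂μ = ∫ u, w (u 0) ∂ν := by
  have hcont := hw.continuous hϖ
  rw [← integral_integral_add_eq μ ν (f := fun y => w (F y)) (by fun_prop)
    (φ := fun u : Fin 1 → R => u 0 • e) (by fun_prop)]
  have h1 : ∀ y, ∫ u : Fin 1 → R, w (F (y + u 0 • e)) ∂ν = ∫ u, w (u 0) ∂ν := by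
    intro y
    refine integral_comp_eq_of_add_eq hϖ hw ν (g := fun a => F (y + a • e)) (by fun_prop) ?_
    intro u a
    obtain ⟨c, hc⟩ := h (y + u • e) a
    exact ⟨c, by rw [add_smul, ← add_assoc, hc]⟩
  simp [h1]

end Cosets

/-! ### Nondegenerate quadratic forms -/

section QuadraticForm

open Matrix Polynomial

variable {R : Type*} [CommRing R]

theorem dotProduct_mulVec_add {r : ℕ} {M : Matrix (Fin r) (Fin r) R} (hM : M.IsSymm)
    (x y : Fin r → R) :
    (x + y) ⬝ᵥ (M *ᵥ (x + y)) = x ⬝ᵥ (M *ᵥ x) + 2 * ((M *ᵥ x) ⬝ᵥ y) + y ⬝ᵥ (M *ᵥ y) := by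
  have h : x ⬝ᵥ (M *ᵥ y) = (M *ᵥ x) ⬝ᵥ y := by
    rw [dotProduct_mulVec, ← mulVec_transpose, hM.eq]
  rw [mulVec_add, dotProduct_add, add_dotProduct, add_dotProduct, h, dotProduct_comm y (M *ᵥ x)]
  ring

/-- A prime power not dividing the discriminant detects some partial derivative of the quadratic
form at every primitive vector. -/
theorem exists_not_dvd_two_mul_mulVec {r : ℕ} {M : Matrix (Fin r) (Fin r) R}
    {ϖ : R} {x : Fin r → R} {i : Fin r} (hx : IsCoprime (x i) ϖ) {N : ℕ}
    (ha : ¬ ϖ ^ N ∣ 2 * M.det) : ∃ i, ¬ ϖ ^ N ∣ 2 * (M *ᵥ x) i := by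
  by_contra! h
  apply ha
  have h1 : ϖ ^ N ∣ 2 * M.det * x i := by
    have h2 : (M.adjugate *ᵥ (M *ᵥ x)) i = M.det * x i := by
      rw [mulVec_mulVec, adjugate_mul, smul_mulVec, one_mulVec]
      rfl
    rw [mul_assoc, ← h2, mulVec, dotProduct, Finset.mul_sum]
    refine Finset.dvd_sum fun j _ => ?_
    rw [mul_left_comm]
    exact (h j).mul_left _
  exact hx.symm.pow_left.dvd_of_dvd_mul_right h1

variable [IsDomain R] [IsDiscreteValuationRing R] {ϖ : R}
  [TopologicalSpace R] [IsTopologicalRing R] [CompactSpace R] [T2Space R]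
  [MeasurableSpace R] [BorelSpace R] [SecondCountableTopology R]

/-- Let ϖ^c be the exact power of ϖ dividing the gradient 2Mx = ϖ^c l. Then c < N and Q(x + ϖ^N y) =
Q(x) + ϖ^(N+c) (l·y + ϖ^(N-c) Q(y)), where some coordinate of l is a unit. If ϖ^(N+c) does not
divide Q(x), then w(Q) is constant on the coset; otherwise the bracket plus a constant has a unit
directional derivative mod ϖ. -/
theorem exists_polynomial_integral_coset (hϖ : Irreducible ϖ) (ν : Measure (Fin 1 → R))
    [ν.IsAddHaarMeasure] [IsProbabilityMeasure ν] {r : ℕ} (μ : Measure (Fin r → R))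
    [μ.IsAddHaarMeasure] [IsProbabilityMeasure μ] {M : Matrix (Fin r) (Fin r) R} (hM : M.IsSymm)
    {x : Fin r → R} {N : ℕ} (hx : ∃ i, ¬ ϖ ^ N ∣ 2 * (M *ᵥ x) i) :
    ∃ f : ℚ[X], ∀ w : R →*₀ ℂ, IsUnramifiedChar ϖ w →
      (1 - w ϖ / (Nat.card (R ⧸ Ideal.span {ϖ}) : ℂ)) *
        ∫ y, w ((x + ϖ ^ N • y) ⬝ᵥ (M *ᵥ (x + ϖ ^ N • y))) ∂μ = aeval (w ϖ) f := by
  classical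
  have hex : ∃ c, ∃ i, ¬ ϖ ^ (c + 1) ∣ 2 * (M *ᵥ x) i := by
    obtain ⟨i, hi⟩ := hx
    exact ⟨N, i, fun h => hi ((pow_dvd_pow ϖ N.le_succ).trans h)⟩
  obtain ⟨c, hcN, i, hi, hall⟩ : ∃ c < N, ∃ i, ¬ ϖ ^ (c + 1) ∣ 2 * (M *ᵥ x) i ∧
      ∀ j, ϖ ^ c ∣ 2 * (M *ᵥ x) j := by
    obtain ⟨i, hi⟩ := Nat.find_spec hex
    refine ⟨Nat.find hex, ?_, i, hi, fun j => ?_⟩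
    · obtain ⟨k, hk⟩ := hx
      obtain ⟨n, rfl⟩ : ∃ n, N = n + 1 := by
        cases N with
        | zero => simp at hk
        | succ n => exact ⟨n, rfl⟩
      exact Nat.lt_succ_of_le (Nat.find_min' hex ⟨k, hk⟩)
    · by_contra h
      obtain ⟨m, hm⟩ : ∃ m, Nat.find hex = m + 1 := by
        refine Nat.exists_eq_succ_of_ne_zero fun h0 => h ?_
        simp [h0]
      exact Nat.find_min hex (m := m) (by omega) ⟨j, hm ▸ h⟩
  choose l hl using hall
  have hli : IsUnit (l i) := by
    by_contra h
    obtain ⟨z, hz⟩ := Ideal.mem_span_singleton.1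
      (hϖ.maximalIdeal_eq ▸ (IsLocalRing.mem_maximalIdeal _).2 h)
    exact hi ⟨z, by rw [hl, hz]; ring⟩
  obtain ⟨ε, hε⟩ := hli
  -- Here N - c = m + 1 ≥ 1, so the quadratic term vanishes mod ϖ.
  obtain ⟨m, rfl⟩ : ∃ m, N = c + 1 + m := ⟨N - (c + 1), by omega⟩
  set N := c + 1 + m with hN
  have hQ : ∀ y, (x + ϖ ^ N • y) ⬝ᵥ (M *ᵥ (x + ϖ ^ N • y)) = x ⬝ᵥ (M *ᵥ x) +
      ϖ ^ (N + c) * (l ⬝ᵥ y + ϖ ^ (m + 1) * (y ⬝ᵥ (M *ᵥ y))) := by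
    intro y
    have h1 : 2 * ((M *ᵥ x) ⬝ᵥ y) = ϖ ^ c * (l ⬝ᵥ y) := by
      simp_rw [dotProduct, Finset.mul_sum, ← mul_assoc, hl]
    rw [dotProduct_mulVec_add hM, mulVec_smul, dotProduct_smul, dotProduct_smul, smul_dotProduct]
    simp only [smul_eq_mul]
    linear_combination ϖ ^ N * h1
  have hq0 : (Nat.card (R ⧸ Ideal.span {ϖ}) : ℂ) ≠ 0 := by
    have := finite_quotient_span_prime_pow hϖ 1
    rw [pow_one] at this
    exact Nat.cast_ne_zero.2 Nat.card_pos.ne'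
  by_cases hd : ϖ ^ (N + c) ∣ x ⬝ᵥ (M *ᵥ x)
  · obtain ⟨b, hb⟩ := hd
    refine ⟨X ^ (N + c) * (1 - C (1 / (Nat.card (R ⧸ Ideal.span {ϖ}) : ℚ))), fun w hw => ?_⟩
    have h1 : ∫ y, w (b + (l ⬝ᵥ y + ϖ ^ (m + 1) * (y ⬝ᵥ (M *ᵥ y)))) ∂μ = ∫ u, w (u 0) ∂ν := by
      refine integral_comp_eq_of_add_smul_eq hϖ hw ν μ
        (F := fun y => b + (l ⬝ᵥ y + ϖ ^ (m + 1) * (y ⬝ᵥ (M *ᵥ y)))) ?_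
        -- The direction e is normalized so that l·e = 1.
        (Pi.single i (↑ε⁻¹ : R)) ?_
      · simp only [dotProduct, mulVec]
        fun_prop
      · intro y a
        set e : Fin r → R := Pi.single i (↑ε⁻¹ : R)
        have he : l ⬝ᵥ e = 1 := by
          rw [dotProduct_single, ← hε]
          exact ε.mul_inv
        refine ⟨ϖ ^ m * (2 * ((M *ᵥ y) ⬝ᵥ e) + a * (e ⬝ᵥ (M *ᵥ e))), ?_⟩
        rw [dotProduct_mulVec_add hM, dotProduct_add, dotProduct_smul, he, mulVec_smul,
          dotProduct_smul, dotProduct_smul, smul_dotProduct]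
        simp only [smul_eq_mul]
        ring
    simp_rw [hQ, hb, ← mul_add, map_mul, map_pow]
    rw [integral_const_mul, h1, mul_left_comm, one_sub_mul_integral_coord hϖ hw ν]
    simp
  · obtain ⟨k, -, u, hu⟩ := exists_unit_mul_pow_of_not_dvd hϖ hd
    refine ⟨(1 - C (1 / (Nat.card (R ⧸ Ideal.span {ϖ}) : ℚ)) * X) * X ^ k, fun w hw => ?_⟩
    have h1 : ∀ y, w ((x + ϖ ^ N • y) ⬝ᵥ (M *ᵥ (x + ϖ ^ N • y))) = w ϖ ^ k := by
      intro y
      rw [hw.map_eq_of_dvd_sub hϖ hd (by rw [hQ]; simp), hu, map_mul, hw.map_unit, map_pow,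
        one_mul]
    simp only [h1, integral_const, probReal_univ, one_smul, map_mul, map_sub, map_one, aeval_C,
      aeval_X, map_pow, map_div₀, map_natCast]
    ring

theorem exists_polynomial_integral_quadraticForm (hϖ : Irreducible ϖ) (ν : Measure (Fin 1 → R))
    [ν.IsAddHaarMeasure] [IsProbabilityMeasure ν] {r : ℕ} (μ : Measure (Fin r → R))
    [μ.IsAddHaarMeasure] [IsProbabilityMeasure μ] {M : Matrix (Fin r) (Fin r) R} (hM : M.IsSymm)
    (hdet : 2 * M.det ≠ 0) :
    ∃ f : ℚ[X], ∀ w : R →*₀ ℂ, IsUnramifiedChar ϖ w →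
      (1 - w ϖ / (Nat.card (R ⧸ Ideal.span {ϖ}) : ℂ)) *
        (1 - w ϖ ^ 2 / (Nat.card (R ⧸ Ideal.span {ϖ}) : ℂ) ^ r) *
          ∫ x, w (x ⬝ᵥ (M *ᵥ x)) ∂μ = aeval (w ϖ) f := by
  classical
  obtain ⟨N, hN⟩ : ∃ N, ¬ ϖ ^ N ∣ 2 * M.det := by
    by_contra! h
    exact hdet (eq_zero_of_forall_pow_dvd hϖ h)
  have := finite_quotient_span_prime_pow hϖ 1
  have := finite_quotient_span_prime_pow hϖ N
  have := Fintype.ofFinite (R ⧸ Ideal.span {ϖ ^ 1})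
  have := Fintype.ofFinite (R ⧸ Ideal.span {ϖ ^ N})
  set Q : (Fin r → R) → R := fun x => x ⬝ᵥ (M *ᵥ x) 
  have hQc : Continuous Q := by
    simp only [Q, dotProduct, mulVec]
    fun_prop
  -- Refining a class mod ϖ by classes mod ϖ^N gives cosets of ϖ^(N+1) R^r. The condition ξ ≠ 0 sits
  -- inside the existential so that `choose` yields a polynomial for every ξ, independent of w.
  have hprim : ∀ (ξ : Fin r → R ⧸ Ideal.span {ϖ ^ 1}) (η : Fin r → R ⧸ Ideal.span {ϖ ^ N}),
      ∃ f : ℚ[X], ξ ≠ 0 → ∀ w : R →*₀ ℂ, IsUnramifiedChar ϖ w →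
        (1 - w ϖ / (Nat.card (R ⧸ Ideal.span {ϖ}) : ℂ)) *
          ∫ y, w (Q (liftPi ξ + ϖ ^ 1 • (liftPi η + ϖ ^ N • y))) ∂μ = aeval (w ϖ) f := by
    intro ξ η
    by_cases hξ : ξ = 0
    · exact ⟨0, fun h => absurd hξ h⟩
    obtain ⟨i, hi⟩ : ∃ i, ¬ ϖ ∣ liftPi ξ i := by
      by_contra! h
      apply hξ
      rw [← reducePi_liftPi ξ]
      ext i
      exact Ideal.Quotient.eq_zero_iff_mem.2 (Ideal.mem_span_singleton.2 (by simpa using h i))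
    have hcop : IsCoprime ((liftPi ξ + ϖ • liftPi η) i) ϖ := by
      refine ((hϖ.coprime_iff_not_dvd).2 fun h => hi ?_).symm
      simpa [dvd_add_left (dvd_mul_right ϖ _)] using h
    obtain ⟨j, hj⟩ := exists_not_dvd_two_mul_mulVec hcop hN
    obtain ⟨f, hf⟩ := exists_polynomial_integral_coset hϖ ν μ hM (N := N + 1)
      ⟨j, fun h => hj ((pow_dvd_pow ϖ N.le_succ).trans h)⟩
    refine ⟨f, fun _ w hw => ?_⟩
    rw [← hf w hw]
    simp only [Q, pow_one, smul_add, smul_smul, pow_succ' ϖ N, add_assoc]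
  choose F hF using hprim
  set q : ℚ := (Nat.card (R ⧸ Ideal.span {ϖ}) : ℚ)
  set p : ℚ := (Fintype.card (R ⧸ Ideal.span {ϖ ^ N}) : ℚ)
  refine ⟨C (q ^ r)⁻¹ * ∑ ξ ∈ Finset.univ.erase 0, C (p ^ r)⁻¹ * ∑ η, F ξ η, fun w hw => ?_⟩
  have hwc := hw.continuous hϖ
  have hcard : Fintype.card (R ⧸ Ideal.span {ϖ ^ 1}) = Nat.card (R ⧸ Ideal.span {ϖ}) := by
    rw [← Nat.card_eq_fintype_card, pow_one]
  -- Homogeneity of degree 2: the zero class returns the original integral.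
  have h0 : ∫ y, w (Q (liftPi (0 : Fin r → R ⧸ Ideal.span {ϖ ^ 1}) + ϖ ^ 1 • y)) ∂μ =
      w ϖ ^ 2 * ∫ x, w (Q x) ∂μ := by
    obtain ⟨z, hz⟩ := reducePi_eq_iff.1
      ((reducePi_liftPi 0).trans (map_zero (reducePi (ϖ ^ 1) r)).symm)
    rw [hz, ← integral_const_mul, ← integral_add_left_eq_self (fun x => w ϖ ^ 2 * w (Q x)) z]
    congr 1 with y
    rw [zero_add, ← smul_add, ← map_pow, ← map_mul]
    simp only [Q, mulVec_smul, dotProduct_smul, smul_dotProduct, smul_eq_mul, pow_one]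
    congr 1
    ring
  have h1 : ∀ ξ ∈ Finset.univ.erase (0 : Fin r → R ⧸ Ideal.span {ϖ ^ 1}),
      (1 - w ϖ / (q : ℂ)) * ∫ y, w (Q (liftPi ξ + ϖ ^ 1 • y)) ∂μ =
        aeval (w ϖ) (C (p ^ r)⁻¹ * ∑ η, F ξ η) := by
    intro ξ hξ
    rw [integral_eq_sum_cosets hϖ N μ (f := fun y => w (Q (liftPi ξ + ϖ ^ 1 • y)))
      (by fun_prop), mul_left_comm, Finset.mul_sum, map_mul, map_sum, aeval_C]
    congr 1
    · simp [p]
    · refine Finset.sum_congr rfl fun η _ => ?_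
      rw [← hF ξ η (Finset.ne_of_mem_erase hξ) w hw]
      simp [q]
  have h2 := integral_eq_sum_cosets hϖ 1 μ (f := fun x => w (Q x)) (by fun_prop)
  rw [← Finset.add_sum_erase _ _ (Finset.mem_univ 0), h0, hcard] at h2
  have hqC : ((q : ℚ) : ℂ) = (Nat.card (R ⧸ Ideal.span {ϖ}) : ℂ) := by simp [q]
  rw [← hqC] at h2 ⊢
  rw [map_mul, map_sum, ← Finset.sum_congr rfl h1, ← Finset.mul_sum, aeval_C, map_inv₀, map_pow,
    eq_ratCast]
  linear_combination (1 - w ϖ / (q : ℂ)) * h2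

end QuadraticForm

/-! ### The normalized absolute value of a local field -/

section LocalField

variable {K : Type*} [Field K] [ValuativeRel K] [TopologicalSpace K] [IsNonarchimedeanLocalField K]

open IsNonarchimedeanLocalField ValuativeRel IgusaZeta

theorem IsNonarchimedeanLocalField.t2Space : T2Space K := by
  let := IsTopologicalAddGroup.rightUniformSpace K
  have := isUniformAddGroup_of_addCommGroup (G := K)
  infer_instance

/-- The value group is countable, so 0 has a countable neighbourhood basis and 𝒪[K] is
pseudometrizable; being compact, it is second countable. -/
theorem IsNonarchimedeanLocalField.secondCountableTopology_integer :
    SecondCountableTopology 𝒪[K] := by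
  let := IsTopologicalAddGroup.rightUniformSpace K
  have := isUniformAddGroup_of_addCommGroup (G := K)
  have : Countable (WithZero (Multiplicative ℤ)) := inferInstanceAs (Countable (Option ℤ))
  have : Countable (ValueGroupWithZero K) :=
    (valueGroupWithZeroIsoInt K).toEquiv.injective.countable
  have : (nhds (0 : K)).IsCountablyGenerated :=
    Filter.HasCountableBasis.isCountablyGenerated
      ⟨IsValuativeTopology.hasBasis_nhds_zero' K, Set.to_countable _⟩
  have : (uniformity K).IsCountablyGenerated := IsUniformAddGroup.uniformity_countably_generated
  have : TopologicalSpace.PseudoMetrizableSpace K := UniformSpace.pseudoMetrizableSpace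
  have : TopologicalSpace.PseudoMetrizableSpace 𝒪[K] :=
    Topology.IsInducing.subtypeVal.pseudoMetrizableSpace
  let := TopologicalSpace.pseudoMetrizableSpacePseudoMetric 𝒪[K]
  infer_instance

theorem IgusaZeta.absK_unit (u : 𝒪[K]ˣ) : absK ((u : 𝒪[K]) : K) = 1 := by
  have h : valuation K ((u : 𝒪[K]) : K) = 1 :=
    (Valuation.Integers.isUnit_iff_valuation_eq_one
      (Valuation.integer.integers (valuation K))).1 u.isUnit
  simp [absK, h]

theorem IgusaZeta.absK_mul (a b : K) : absK (a * b) = absK a * absK b := by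
  simp [absK]

theorem IgusaZeta.absK_nonneg (a : K) : 0 ≤ absK a :=
  NNReal.coe_nonneg _

theorem IgusaZeta.absK_zero : absK (0 : K) = 0 := by
  simp [absK]

/-- Some x has value exp(-1). Writing x = uϖ^k and exp(j) for the value of ϖ gives kj = -1 with j <
0, hence k = 1. -/
theorem IgusaZeta.valueGroupWithZeroIsoInt_valuation_prime {ϖ : 𝒪[K]} (hϖ : Irreducible ϖ) :
    valueGroupWithZeroIsoInt K (valuation K (ϖ : K)) = WithZero.exp (-1) := by
  set e := valueGroupWithZeroIsoInt K
  have hlt : e (valuation K (ϖ : K)) < 1 := by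
    rw [← map_one e]
    exact (map_lt_map_iff e).2
      ((Valuation.integer.integers (valuation K)).valuation_irreducible_lt_one hϖ)
  have hne : e (valuation K (ϖ : K)) ≠ 0 := by
    have : (ϖ : K) ≠ 0 := fun h => hϖ.ne_zero (Subtype.ext h)
    simpa using this
  obtain ⟨x, hx⟩ := valuation_surjective (e.symm (WithZero.exp (-1)))
  have hex : e (valuation K x) = WithZero.exp (-1) := by rw [hx]; simp
  have hx1 : valuation K x ≤ 1 := by
    rw [← map_le_map_iff e, hex, map_one, ← WithZero.exp_zero, WithZero.exp_le_exp]
    norm_num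
  have hx0 : (⟨x, hx1⟩ : 𝒪[K]) ≠ 0 := by
    intro h
    have : x = 0 := congrArg Subtype.val h
    rw [this, map_zero, map_zero] at hex
    exact WithZero.exp_ne_zero hex.symm
  obtain ⟨k, u, hk⟩ := IsDiscreteValuationRing.eq_unit_mul_pow_irreducible hx0 hϖ
  have hk' : x = ((u : 𝒪[K]) : K) * (ϖ : K) ^ k := congrArg Subtype.val hk
  have hu : valuation K ((u : 𝒪[K]) : K) = 1 :=
    (Valuation.Integers.isUnit_iff_valuation_eq_one
      (Valuation.integer.integers (valuation K))).1 u.isUnit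
  rw [hk', map_mul, hu, one_mul, map_pow, map_pow] at hex
  obtain ⟨j, hj⟩ : ∃ j : ℤ, e (valuation K (ϖ : K)) = WithZero.exp j :=
    ⟨_, (WithZero.exp_log hne).symm⟩
  rw [hj] at hlt hex ⊢
  rw [← WithZero.exp_zero, WithZero.exp_lt_exp] at hlt
  rw [← WithZero.exp_nsmul, WithZero.exp_inj, nsmul_eq_mul] at hex
  have : (k : ℤ) = 1 := by nlinarith [Int.natCast_nonneg k]
  rw [this, one_mul] at hex
  rw [hex]

theorem IgusaZeta.absK_prime {ϖ : 𝒪[K]} (hϖ : Irreducible ϖ) :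
    absK (ϖ : K) = (residueCard K : ℝ)⁻¹ := by
  rw [absK, valueGroupWithZeroIsoInt_valuation_prime hϖ,
    WithZeroMulInt.toNNReal_neg_apply _ WithZero.exp_ne_zero]
  have h : ∀ h0, Multiplicative.toAdd (WithZero.unzero (x := WithZero.exp (-1 : ℤ)) h0) = -1 :=
    fun _ => rfl
  rw [h]
  simp

theorem IgusaZeta.one_lt_residueCard : 1 < residueCard K :=
  Finite.one_lt_card

theorem IgusaZeta.card_quotient_span_prime {ϖ : 𝒪[K]} (hϖ : Irreducible ϖ) :
    Nat.card (𝒪[K] ⧸ Ideal.span {ϖ}) = residueCard K := by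
  rw [← hϖ.maximalIdeal_eq]
  rfl

/-- The function `a ↦ |a| ^ s` on the valuation ring. -/
noncomputable def IgusaZeta.absPow (s : ℂ) (hs : 0 < s.re) : 𝒪[K] →*₀ ℂ where
  toFun a := (absK (a : K) : ℂ) ^ s
  map_zero' := by
    have : s ≠ 0 := fun h => by simp [h] at hs
    simp [absK_zero, this]
  map_one' := by simpa using congrArg (fun x : ℝ => (x : ℂ) ^ s) (absK_unit (K := K) 1)
  map_mul' a b := by
    rw [← Complex.mul_cpow_ofReal_nonneg (absK_nonneg _) (absK_nonneg _), ← Complex.ofReal_mul,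
      ← absK_mul]
    rfl

theorem IgusaZeta.absPow_prime {ϖ : 𝒪[K]} (hϖ : Irreducible ϖ) {s : ℂ} (hs : 0 < s.re) :
    absPow s hs ϖ = (residueCard K : ℂ) ^ (-s) := by
  change (absK (ϖ : K) : ℂ) ^ s = _
  rw [absK_prime hϖ, Complex.ofReal_inv, Complex.ofReal_natCast, Complex.inv_cpow,
    Complex.cpow_neg]
  simp [Complex.natCast_arg, Real.pi_ne_zero.symm]

theorem IgusaZeta.norm_residueCard_cpow_neg_lt_one {s : ℂ} (hs : 0 < s.re) :
    ‖(residueCard K : ℂ) ^ (-s)‖ < 1 := by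
  rw [Complex.norm_natCast_cpow_of_pos (zero_lt_one.trans one_lt_residueCard)]
  refine Real.rpow_lt_one_of_one_lt_of_neg ?_ (by simpa using hs)
  exact_mod_cast one_lt_residueCard (K := K)

theorem IgusaZeta.isUnramifiedChar_absPow {ϖ : 𝒪[K]} (hϖ : Irreducible ϖ) {s : ℂ}
    (hs : 0 < s.re) : IsUnramifiedChar ϖ (absPow s hs) where
  map_unit u := by
    change (absK ((u : 𝒪[K]) : K) : ℂ) ^ s = 1
    simp [absK_unit]
  norm_lt_one := by
    rw [absPow_prime hϖ]
    exact norm_residueCard_cpow_neg_lt_one hs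

end LocalField

/-! ### Splitting off the radical of a symmetric matrix -/

section Reduction

open Matrix

/-- Over a principal ideal domain the image of M is free, so R^n → im M ≅ R^r splits; A is this map
and S a section. As ker A ⊆ ker M, MSA = M; transposing gives AᵀSᵀM = M, so N = SᵀMS works. -/
theorem Matrix.IsSymm.exists_nondegenerate_factorization {R : Type*} [CommRing R] [IsDomain R]
    [IsPrincipalIdealRing R] {n : ℕ} {M : Matrix (Fin n) (Fin n) R} (hM : M.IsSymm) :
    ∃ (r : ℕ) (A : Matrix (Fin r) (Fin n) R) (S : Matrix (Fin n) (Fin r) R)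
      (N : Matrix (Fin r) (Fin r) R),
      A * S = 1 ∧ N.IsSymm ∧ N.det ≠ 0 ∧ M = Aᵀ * N * A := by
  let b := Module.finBasis R M.mulVecLin.range
  let φ := b.equivFun.toLinearMap ∘ₗ M.mulVecLin.rangeRestrict
  have hφ : Function.Surjective φ :=
    b.equivFun.surjective.comp M.mulVecLin.surjective_rangeRestrict
  have hker : ∀ x, φ x = 0 → M *ᵥ x = 0 := by
    intro x hx
    have h := b.equivFun.map_eq_zero_iff.1 hx
    exact congrArg Subtype.val h
  obtain ⟨σ, hσ⟩ := Module.projective_lifting_property φ LinearMap.id hφ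
  set A := LinearMap.toMatrix' φ
  set S := LinearMap.toMatrix' σ
  have hA : ∀ x, A *ᵥ x = φ x := fun x => LinearMap.toMatrix'_mulVec φ x
  have hAS : A * S = 1 := by
    rw [← LinearMap.toMatrix'_comp, hσ, LinearMap.toMatrix'_id]
  have hMSA : M * S * A = M := by
    rw [← sub_eq_zero]
    refine Matrix.toLin'.injective (LinearMap.ext fun x => ?_)
    rw [toLin'_apply, map_zero, LinearMap.zero_apply, Matrix.mul_assoc]
    have : (M * (S * A) - M) *ᵥ x = M *ᵥ ((S * A) *ᵥ x - x) := by
      rw [sub_mulVec, mulVec_sub, mulVec_mulVec]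
    rw [this]
    refine hker _ ?_
    rw [← hA, mulVec_sub, mulVec_mulVec, ← Matrix.mul_assoc, hAS, Matrix.one_mul, sub_self]
  have hfac : M = Aᵀ * (Sᵀ * M * S) * A := by
    have h : Aᵀ * Sᵀ * M = M := by
      have := congrArg Matrix.transpose hMSA
      rwa [transpose_mul, transpose_mul, hM.eq, ← Matrix.mul_assoc] at this
    calc M = Aᵀ * Sᵀ * M * S * A := by rw [h, hMSA]
      _ = _ := by simp only [Matrix.mul_assoc]
  refine ⟨_, A, S, Sᵀ * M * S, hAS, ?_, ?_, hfac⟩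
  · simp [Matrix.IsSymm, hM.eq, Matrix.mul_assoc]
  · intro hdet
    obtain ⟨v, hv0, hv⟩ := exists_mulVec_eq_zero_iff.2 hdet
    apply hv0
    have h1 : A *ᵥ (S *ᵥ v) = v := by rw [mulVec_mulVec, hAS, one_mulVec]
    have h2 : M *ᵥ (S *ᵥ v) = 0 := by
      refine (congrArg (· *ᵥ (S *ᵥ v)) hfac).trans ?_
      rw [← mulVec_mulVec, h1, ← mulVec_mulVec, hv, mulVec_zero]
    have h3 : φ (S *ᵥ v) = 0 := by
      refine b.equivFun.map_eq_zero_iff.2 (Subtype.ext ?_)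
      exact h2
    rw [← h1, hA, h3]

theorem Matrix.rank_transpose_mul_mul {F : Type*} [Field F] {n r : ℕ}
    {A : Matrix (Fin r) (Fin n) F} {S : Matrix (Fin n) (Fin r) F} {N : Matrix (Fin r) (Fin r) F}
    (hAS : A * S = 1) (hN : N.det ≠ 0) : (Aᵀ * N * A).rank = r := by
  have hNr : N.rank = r := by
    rw [rank_of_isUnit N ((isUnit_iff_isUnit_det N).2 hN.isUnit), Fintype.card_fin]
  refine le_antisymm ?_ ?_
  · exact (rank_mul_le_right _ _).trans ((rank_le_card_height A).trans (by simp))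
  · have h : N = Sᵀ * (Aᵀ * N * A) * S := by
      have h1 : Sᵀ * Aᵀ = 1 := by rw [← transpose_mul, hAS, transpose_one]
      calc N = (Sᵀ * Aᵀ) * N * (A * S) := by rw [h1, hAS, Matrix.one_mul, Matrix.mul_one]
        _ = _ := by simp only [Matrix.mul_assoc]
    calc r = N.rank := hNr.symm
      _ = (Sᵀ * (Aᵀ * N * A) * S).rank := by rw [← h]
      _ ≤ _ := (rank_mul_le_left _ _).trans (rank_mul_le_right _ _)

end Reduction

/-! ### Evaluation of fractions not in lowest terms -/

section RationalFunction

open Polynomial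

theorem RatFunc.eval_algebraMap_div.{u} {F L : Type u} [Field F] [Field L] (φ : F →+* L)
    (p d : F[X]) (a : L) (hd : d.eval₂ φ a ≠ 0) :
    RatFunc.eval φ a (algebraMap F[X] (RatFunc F) p / algebraMap F[X] (RatFunc F) d) =
      p.eval₂ φ a / d.eval₂ φ a := by
  set Z := algebraMap F[X] (RatFunc F) p / algebraMap F[X] (RatFunc F) d with hZ
  have hd0 : d ≠ 0 := fun h => by simp [h] at hd
  obtain ⟨e, he⟩ : Z.denom ∣ d := RatFunc.denom_div_dvd p d
  have hden : Z.denom.eval₂ φ a ≠ 0 := fun h => hd (by rw [he, eval₂_mul, h, zero_mul])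
  have h := congrArg (eval₂ φ a) ((RatFunc.num_mul_eq_mul_denom_iff hd0).2 hZ)
  rw [eval₂_mul, eval₂_mul] at h
  rw [RatFunc.eval, div_eq_div_iff hden hd, h]

end RationalFunction

/-! ### Haar measure on powers of the valuation ring -/

namespace IgusaZeta

open Matrix Polynomial

variable {K : Type*} [Field K] [ValuativeRel K] [TopologicalSpace K] [IsNonarchimedeanLocalField K]

omit [TopologicalSpace K] [IsNonarchimedeanLocalField K] in
theorem eval_quadForm {n : ℕ} (M : Matrix (Fin n) (Fin n) 𝒪[K]) (x : Fin n → 𝒪[K]) :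
    MvPolynomial.eval (fun i => (x i : K)) (quadForm M) = ((x ⬝ᵥ (M *ᵥ x) : 𝒪[K]) : K) := by
  simp only [quadForm, map_sum, map_mul, MvPolynomial.eval_C, MvPolynomial.eval_X, dotProduct,
    mulVec, Finset.mul_sum]
  push_cast
  exact Finset.sum_congr rfl fun i _ => Finset.sum_congr rfl fun j _ => by ring

variable [MeasurableSpace K] [BorelSpace K]

instance (n : ℕ) : IsProbabilityMeasure (haarPow (K := K) n) := by
  have : IsProbabilityMeasure (Measure.addHaarMeasure (⊤ : TopologicalSpace.PositiveCompacts 𝒪[K])) :=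
    ⟨Measure.addHaarMeasure_self⟩
  unfold haarPow
  infer_instance

instance (n : ℕ) : (haarPow (K := K) n).IsAddHaarMeasure := by
  have := IsNonarchimedeanLocalField.secondCountableTopology_integer (K := K)
  unfold haarPow
  infer_instance

/-- A is a continuous surjective homomorphism of compact groups, so it pushes the probability Haar
measure to the probability Haar measure. -/
theorem integral_haarPow_comp_mulVec {n r : ℕ} {A : Matrix (Fin r) (Fin n) 𝒪[K]}
    {S : Matrix (Fin n) (Fin r) 𝒪[K]} (hAS : A * S = 1) {f : (Fin r → 𝒪[K]) → ℂ}
    (hf : Continuous f) : ∫ x, f (A *ᵥ x) ∂(haarPow n) = ∫ y, f y ∂(haarPow r) := by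
  have := IsNonarchimedeanLocalField.secondCountableTopology_integer (K := K)
  have hc : Continuous A.mulVecLin.toAddMonoidHom := by
    exact continuous_const.matrix_mulVec continuous_id
  have hmp : MeasurePreserving A.mulVecLin.toAddMonoidHom (haarPow n) (haarPow r) := by
    refine AddMonoidHom.measurePreserving hc (fun y => ⟨S *ᵥ y, ?_⟩) (by simp)
    change A *ᵥ (S *ᵥ y) = y
    rw [mulVec_mulVec, hAS, one_mulVec]
  rw [← hmp.map_eq, integral_map hmp.measurable.aemeasurable hf.aestronglyMeasurable]
  rfl

end IgusaZeta

/-! ### The main theorem -/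

open Matrix Polynomial

theorem mainTheorem6 {K : Type*} [Field K] [ValuativeRel K] [TopologicalSpace K]
    [IsNonarchimedeanLocalField K] [CharZero K] [MeasurableSpace K] [BorelSpace K]
    {n : ℕ} (M : Matrix (Fin n) (Fin n) 𝒪[K]) (hM : M.IsSymm) :
    ∃ Z : RatFunc ℚ,
      IgusaZeta.IsIgusaZeta (IgusaZeta.quadForm M) Z ∧
      (∃ f : Polynomial ℚ,
        Z = algebraMap (Polynomial ℚ) (RatFunc ℚ) f /
          ((1 - RatFunc.X / (IgusaZeta.residueCard K : RatFunc ℚ)) *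
            (1 - RatFunc.X ^ 2 /
              (IgusaZeta.residueCard K : RatFunc ℚ) ^ IgusaZeta.formRank M))) ∧
      (IgusaZeta.complexPoles Z).card ≤ 3 := by
  have hT2 := IsNonarchimedeanLocalField.t2Space (K := K)
  have hsc := IsNonarchimedeanLocalField.secondCountableTopology_integer (K := K)
  obtain ⟨r, A, S, N, hAS, hN, hdet, hfac⟩ := hM.exists_nondegenerate_factorization
  have hrank : IgusaZeta.formRank M = r := by
    have h1 : A.map (algebraMap 𝒪[K] K) * S.map (algebraMap 𝒪[K] K) = 1 := by
      rw [← Matrix.map_mul, hAS, Matrix.map_one _ (map_zero _) (map_one _)]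
    have h2 : (N.map (algebraMap 𝒪[K] K)).det ≠ 0 := by
      rw [← RingHom.mapMatrix_apply, ← RingHom.map_det]
      exact fun h => hdet (Subtype.ext h)
    have h3 := Matrix.rank_transpose_mul_mul h1 h2
    rw [← Matrix.transpose_map, ← Matrix.map_mul, ← Matrix.map_mul, ← hfac] at h3
    exact h3
  obtain ⟨ϖ, hϖ⟩ := IsDiscreteValuationRing.exists_irreducible 𝒪[K]
  -- Characteristic 0 enters here.
  have hdet2 : 2 * N.det ≠ 0 := by
    refine mul_ne_zero (fun h => ?_) hdet
    have : (2 : K) = 0 := congrArg Subtype.val h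
    exact two_ne_zero this
  obtain ⟨f, hf⟩ := exists_polynomial_integral_quadraticForm hϖ (IgusaZeta.haarPow 1)
    (IgusaZeta.haarPow r) hN hdet2
  rw [IgusaZeta.card_quotient_span_prime hϖ] at hf
  set q := IgusaZeta.residueCard K with hq
  have hq1 : 1 < q := IgusaZeta.one_lt_residueCard
  set D : ℚ[X] := (1 - C (1 / (q : ℚ)) * X) * (1 - C (1 / (q : ℚ) ^ r) * X ^ 2) with hD
  have hDmap : algebraMap ℚ[X] (RatFunc ℚ) D =
      (1 - RatFunc.X / (q : RatFunc ℚ)) * (1 - RatFunc.X ^ 2 / (q : RatFunc ℚ) ^ r) := by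
    simp only [hD, map_mul, map_sub, map_one, map_pow, RatFunc.algebraMap_X, RatFunc.algebraMap_C,
      map_div₀, map_natCast]
    ring
  have hD0 : D ≠ 0 := fun h => by
    have := congrArg (Polynomial.eval 0) h
    simp [hD] at this
  have haevalD : ∀ t : ℂ, aeval t D = (1 - t / (q : ℂ)) * (1 - t ^ 2 / (q : ℂ) ^ r) := by
    intro t
    simp only [hD, map_mul, map_sub, map_one, map_pow, aeval_X, aeval_C, map_div₀, map_natCast]
    ring
  -- D has no zero in the open unit disc, where t = q^(-s) lies for Re s > 0.
  have hDt : ∀ t : ℂ, ‖t‖ < 1 → aeval t D ≠ 0 := by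
    have key : ∀ (t : ℂ) (k m : ℕ), ‖t‖ < 1 → k ≠ 0 → 1 - t ^ k / (q : ℂ) ^ m ≠ 0 := by
      intro t k m ht hk h
      have h1 : ‖t ^ k / (q : ℂ) ^ m‖ = 1 := by rw [← sub_eq_zero.1 h, norm_one]
      rw [norm_div, norm_pow, norm_pow, Complex.norm_natCast] at h1
      have h2 : ‖t‖ ^ k < 1 := pow_lt_one₀ (norm_nonneg _) ht hk
      have h3 : (1 : ℝ) ≤ (q : ℝ) ^ m := one_le_pow₀ (by exact_mod_cast hq1.le)
      rw [div_eq_one_iff_eq (by positivity)] at h1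
      linarith
    intro t ht
    rw [haevalD]
    exact mul_ne_zero (by simpa using key t 1 1 ht one_ne_zero) (key t 2 r ht two_ne_zero)
  have hdvd := RatFunc.denom_div_dvd f D
  refine ⟨algebraMap ℚ[X] (RatFunc ℚ) f / algebraMap ℚ[X] (RatFunc ℚ) D, fun s hs => ?_,
    ⟨f, by rw [hDmap, hrank]⟩, ?_⟩
  · have hw := IgusaZeta.isUnramifiedChar_absPow hϖ hs
    have hwc := hw.continuous hϖ
    have hint : IgusaZeta.integrand (IgusaZeta.quadForm M) s =
        fun x => IgusaZeta.absPow s hs (x ⬝ᵥ (M *ᵥ x)) := by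
      ext x
      rw [IgusaZeta.integrand, IgusaZeta.eval_quadForm]
      rfl
    have ht : ‖(q : ℂ) ^ (-s)‖ < 1 := IgusaZeta.norm_residueCard_cpow_neg_lt_one hs
    refine ⟨?_, ?_, ?_⟩
    · rw [hint]
      refine Continuous.integrable_of_compactSpace _ ?_
      simp only [dotProduct, mulVec]
      fun_prop
    · intro h
      obtain ⟨e, he⟩ := hdvd
      exact hDt _ ht (by rw [he, map_mul, h, zero_mul])
    · have heval : RatFunc.eval (algebraMap ℚ ℂ) ((q : ℂ) ^ (-s))
          (algebraMap ℚ[X] (RatFunc ℚ) f / algebraMap ℚ[X] (RatFunc ℚ) D) =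
          aeval ((q : ℂ) ^ (-s)) f / aeval ((q : ℂ) ^ (-s)) D :=
        RatFunc.eval_algebraMap_div _ f D _ (hDt _ ht)
      rw [heval, IgusaZeta.igusaZeta, hint,
        eq_div_iff (hDt _ ht)]
      have h1 : ∀ x : Fin n → 𝒪[K], x ⬝ᵥ (M *ᵥ x) = (A *ᵥ x) ⬝ᵥ (N *ᵥ (A *ᵥ x)) := by
        intro x
        rw [hfac, ← mulVec_mulVec, ← mulVec_mulVec, dotProduct_mulVec, vecMul_transpose]
      have h2 := hf _ hw
      rw [IgusaZeta.absPow_prime hϖ hs, ← haevalD] at h2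
      simp_rw [h1]
      rw [IgusaZeta.integral_haarPow_comp_mulVec hAS
        (f := fun y => IgusaZeta.absPow s hs (y ⬝ᵥ (N *ᵥ y)))
        (by simp only [dotProduct, mulVec]; fun_prop), mul_comm]
      exact h2
  -- The reduced denominator divides D, which has degree at most 3.
  · refine (Polynomial.card_roots' _).trans (natDegree_map_le.trans
      ((natDegree_le_of_dvd hdvd hD0).trans ?_))
    rw [hD]
    compute_degree
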